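/- Let $H$ be a complex Hilbert space and let $\mathbf T=(T_1,\dots,T_d)$ be a $d$-tuple of bounded linear operators on $H$ (not assumed to commute). Write $\mathbf T^2$ for the $d^2$-tuple of all products $T_iT_j$, $1\le i,j\le d$. Let $P=(T_1^*T_1+\cdots+T_d^*T_d)^{1/2}$, and let $\mathbf T=\mathbf VP$, i.e. $T_i=V_iP$ for $i=1,\dots,d$, be the canonical spherical polar decomposition of $\mathbf T$: $\mathbf V=(V_1,\dots,V_d)$ is the unique $d$-tuple of bounded operators with $T_i=V_iP$ for all $i$ and such that $V_1^*V_1+\cdots+V_d^*V_d$ is the orthogonal projection onto $\bigl(\bigcap_{i=1}^d\ker T_i\bigr)^\perp$. For $t\in[0,1]$, with $P^0=I$, the generalized spherical Aluthge transform and the spherical Heinz transform of $\mathbf T$ are $$\widetilde{\mathbf T}(t)=(P^tV_1P^{1-t},\dots,P^tV_dP^{1-t}),\qquad \widehat{\mathbf T}(t)=\tfrac12\bigl(\widetilde{\mathbf T}(t)+\widetilde{\mathbf T}(1-t)\bigr).$$ **Theorem.** The following conditions are equivalent: 1. $\mathbf T^2=\mathbf 0$; 2. $\widetilde{\mathbf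 T}(t)=\mathbf 0$ for each $t\in(0,1]$; 3. $\widetilde{\mathbf T}(t)=\mathbf 0$ for some $t\in(0,1]$; 4. $\widehat{\mathbf T}(t)=\mathbf 0$ for each $t\in(0,1)$; 5. $\widehat{\mathbf T}(t)=\mathbf 0$ for some $t\in(0,1)$. -/

import Mathlib

open scoped InnerProductSpace

namespace SphericalTuple

noncomputable section

variable {H : Type*} [NormedAddCommGroup H] [InnerProductSpace ℂ H]

/-- The product `T ∘ S = (T₁S₁, …, T₁Sₙ, …, T_mS₁, …, T_mSₙ)` of an `m`-tuple and an `n`-tuple of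
bounded operators, listed in lexicographic order: position `k = j + n * i` carries `Tᵢ Sⱼ`. -/
def tupleProd {m n : ℕ} (T : Fin m → H →L[ℂ] H) (S : Fin n → H →L[ℂ] H) :
    Fin (m * n) → H →L[ℂ] H :=
  fun k => T k.divNat * S k.modNat

/-- The square `T² = T ∘ T` of a tuple of bounded operators. -/
def tupleSq {d : ℕ} (T : Fin d → H →L[ℂ] H) : Fin (d * d) → H →L[ℂ] H :=
  tupleProd T T

/-- The null space `⋂ᵢ ker Tᵢ` of the column operator `x ↦ (T₁ x, …, T_d x)`. -/
def jointKernel {d : ℕ} (T : Fin d → H →L[ℂ] H) : Submodule ℂ H :=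
  ⨅ i, (T i).ker

lemma inner_starProjection_self (K : Submodule ℂ H) [K.HasOrthogonalProjection] (x : H) :
    ⟪K.starProjection x, x⟫_ℂ = ((‖K.starProjection x‖ ^ 2 : ℝ) : ℂ) := by
  have h1 : K.starProjection (K.starProjection x) = K.starProjection x :=
    Submodule.starProjection_eq_self_iff.2 (Submodule.starProjection_apply_mem K x)
  rw [← h1, Submodule.inner_starProjection_left_eq_right, h1, inner_self_eq_norm_sq_to_K]
  push_cast
  rfl

variable [CompleteSpace H]

/-- The modulus `P = (T₁* T₁ + ⋯ + T_d* T_d)^{1/2}` of a tuple. -/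
def sphericalModulus {d : ℕ} (T : Fin d → H →L[ℂ] H) : H →L[ℂ] H :=
  CFC.sqrt (∑ i, star (T i) * T i)

/-- `V` is the partial isometry of the canonical spherical polar decomposition of `T`:
`Tᵢ = Vᵢ P` for all `i`, and the column `V` is a partial isometry with initial space
`(⋂ᵢ ker Tᵢ)ᗮ`, that is, `V₁* V₁ + ⋯ + V_d* V_d` is the orthogonal projection onto this space. -/
structure IsSphericalPolar {d : ℕ} (T V : Fin d → H →L[ℂ] H) : Prop where
  eq_mul : ∀ i, T i = V i * sphericalModulus T
  initial : ∑ i, star (V i) * V i = (jointKernel T)ᗮ.starProjection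

lemma inner_sum_star_mul {d : ℕ} (T : Fin d → H →L[ℂ] H) (x : H) :
    ⟪(∑ i, star (T i) * T i) x, x⟫_ℂ = ((∑ i, ‖T i x‖ ^ 2 : ℝ) : ℂ) := by
  rw [sum_apply, sum_inner]
  push_cast
  refine Finset.sum_congr rfl fun i _ => ?_
  rw [ContinuousLinearMap.star_eq_adjoint]
  exact (ContinuousLinearMap.adjoint_inner_left _ _ _).trans (inner_self_eq_norm_sq_to_K _)

lemma sphericalModulus_inner {d : ℕ} (T : Fin d → H →L[ℂ] H) (x y : H) :
    ⟪sphericalModulus T x, y⟫_ℂ = ⟪x, sphericalModulus T y⟫_ℂ := by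
  have h : IsSelfAdjoint (sphericalModulus T) :=
    IsSelfAdjoint.of_nonneg (CFC.sqrt_nonneg _)
  have h2 := h.star_eq
  rw [ContinuousLinearMap.star_eq_adjoint] at h2
  conv_lhs => rw [← h2]
  rw [ContinuousLinearMap.adjoint_inner_left]

lemma norm_sphericalModulus_sq {d : ℕ} (T : Fin d → H →L[ℂ] H) (x : H) :
    ‖sphericalModulus T x‖ ^ 2 = ∑ i, ‖T i x‖ ^ 2 := by
  have h0 : (0 : H →L[ℂ] H) ≤ ∑ i, star (T i) * T i :=
    Finset.sum_nonneg fun i _ => star_mul_self_nonneg _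
  have h1 := CFC.sqrt_mul_sqrt_self _ h0
  have h2 := inner_sum_star_mul T x
  rw [← h1] at h2
  have h3 := sphericalModulus_inner T (sphericalModulus T x) x
  have h4 := inner_self_eq_norm_sq_to_K (𝕜 := ℂ) (sphericalModulus T x)
  have h5 := (h4.symm.trans h3.symm).trans h2
  refine Complex.ofReal_injective ?_
  rw [← h5]
  push_cast
  rfl

lemma sphericalModulus_apply_eq_zero_iff {d : ℕ} (T : Fin d → H →L[ℂ] H) (x : H) :
    sphericalModulus T x = 0 ↔ x ∈ jointKernel T := by
  have h := norm_sphericalModulus_sq T x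
  rw [jointKernel, Submodule.mem_iInf]
  constructor
  · intro hx i
    rw [hx, norm_zero, zero_pow two_ne_zero, eq_comm,
      Finset.sum_eq_zero_iff_of_nonneg fun _ _ => sq_nonneg _] at h
    simpa using h i (Finset.mem_univ i)
  · intro hx
    have : ∑ i, ‖T i x‖ ^ 2 = 0 := Finset.sum_eq_zero fun i _ => by
      have hi : T i x = 0 := hx i
      simp [hi]
    rw [this] at h
    simpa using h

lemma sphericalModulus_mem {d : ℕ} (T : Fin d → H →L[ℂ] H) (x : H) :
    sphericalModulus T x ∈ (jointKernel T)ᗮ := by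
  rw [Submodule.mem_orthogonal]
  intro u hu
  rw [← sphericalModulus_inner, (sphericalModulus_apply_eq_zero_iff T u).2 hu, inner_zero_left]

/-- Every tuple has a canonical spherical polar decomposition. -/
theorem exists_isSphericalPolar {d : ℕ} (T : Fin d → H →L[ℂ] H) :
    ∃ V : Fin d → H →L[ℂ] H, IsSphericalPolar T V := by
  let K : Submodule ℂ H := (jointKernel T)ᗮ
  let e : H →ₗ[ℂ] K :=
    (sphericalModulus T).toLinearMap.codRestrict K (sphericalModulus_mem T)
  have he : ∀ x, (e x : H) = sphericalModulus T x := fun x => rfl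
  have hdense : DenseRange e := by
    have h : (LinearMap.range e).topologicalClosure = ⊤ := by
      rw [Submodule.topologicalClosure_eq_top_iff, Submodule.eq_bot_iff]
      intro y hy
      rw [Submodule.mem_orthogonal] at hy
      have h1 : sphericalModulus T (y : H) = 0 := by
        refine ext_inner_left ℂ fun v => ?_
        rw [inner_zero_right, ← sphericalModulus_inner]
        exact hy (e v) ⟨v, rfl⟩
      have h2 := (sphericalModulus_apply_eq_zero_iff T _).1 h1
      have h3 : ⟪(y : H), (y : H)⟫_ℂ = 0 :=
        (Submodule.mem_orthogonal _ _).1 y.2 _ h2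
      exact Subtype.ext (inner_self_eq_zero.1 h3)
    have h' := (Submodule.dense_iff_topologicalClosure_eq_top).2 h
    rw [DenseRange, ← LinearMap.coe_range]
    exact h'
  have hbound : ∀ i x, ‖(T i).toLinearMap x‖ ≤ 1 * ‖e x‖ := by
    intro i x
    rw [one_mul]
    refine le_of_sq_le_sq ?_ (norm_nonneg _)
    have h : ‖e x‖ ^ 2 = ∑ i, ‖T i x‖ ^ 2 := norm_sphericalModulus_sq T x
    rw [h]
    exact Finset.single_le_sum (f := fun i => ‖T i x‖ ^ 2) (fun _ _ => sq_nonneg _)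
      (Finset.mem_univ i)
  let W : Fin d → K →L[ℂ] H := fun i => (T i).toLinearMap.extendOfNorm e
  have hW : ∀ i x, W i (e x) = T i x := fun i x =>
    LinearMap.extendOfNorm_eq hdense ⟨1, hbound i⟩ x
  have hWn : ∀ k : K, ∑ i, ‖W i k‖ ^ 2 = ‖k‖ ^ 2 := by
    intro k
    refine hdense.induction_on k (isClosed_eq (by fun_prop) (by fun_prop)) fun x => ?_
    simp only [hW]
    exact (norm_sphericalModulus_sq T x).symm
  refine ⟨fun i => (W i).comp K.orthogonalProjectionOnto, ?_, ?_⟩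
  · intro i
    ext x
    have h : K.orthogonalProjectionOnto (sphericalModulus T x) = e x :=
      Submodule.orthogonalProjectionOnto_mem_subspace_eq_self (e x)
    simp [h, hW]
  · refine ContinuousLinearMap.coe_injective ((ext_inner_map _ _).1 fun x => ?_)
    simp only [ContinuousLinearMap.coe_coe]
    rw [inner_sum_star_mul]
    have h1 : ∑ i, ‖((W i).comp K.orthogonalProjectionOnto) x‖ ^ 2 = ‖K.starProjection x‖ ^ 2 :=
      hWn (K.orthogonalProjectionOnto x)
    rw [h1, inner_starProjection_self]

/-- The partial isometry of the canonical spherical polar decomposition is unique. -/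
theorem IsSphericalPolar.unique {d : ℕ} {T V V' : Fin d → H →L[ℂ] H}
    (h : IsSphericalPolar T V) (h' : IsSphericalPolar T V') : V = V' := by
  have key : ∀ U : Fin d → H →L[ℂ] H, IsSphericalPolar T U → ∀ x ∈ jointKernel T, ∀ i, U i x = 0 := by
    intro U hU x hx i
    have h1 := inner_sum_star_mul U x
    have h2 : (jointKernel T)ᗮ.starProjection x = 0 :=
      (Submodule.starProjection_apply_eq_zero_iff _).2 (Submodule.le_orthogonal_orthogonal _ hx)
    rw [hU.initial, h2, inner_zero_left, eq_comm, Complex.ofReal_eq_zero,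
      Finset.sum_eq_zero_iff_of_nonneg fun _ _ => sq_nonneg _] at h1
    simpa using h1 i (Finset.mem_univ i)
  funext i
  have hker : (V i - V' i).ker = ⊤ := by
    have hcl : IsClosed ((V i - V' i).ker : Set H) := (V i - V' i).isClosed_ker
    have : CompleteSpace (V i - V' i).ker := hcl.completeSpace_coe
    rw [← Submodule.orthogonal_eq_bot_iff, Submodule.eq_bot_iff]
    intro y hy
    rw [Submodule.mem_orthogonal] at hy
    have h1 : sphericalModulus T y = 0 := by
      refine ext_inner_left ℂ fun v => ?_
      rw [inner_zero_right, ← sphericalModulus_inner]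
      refine hy _ ?_
      have e1 : V i (sphericalModulus T v) = T i v := by rw [h.eq_mul i]; rfl
      have e2 : V' i (sphericalModulus T v) = T i v := by rw [h'.eq_mul i]; rfl
      simp [e1, e2]
    have h2 := (sphericalModulus_apply_eq_zero_iff T y).1 h1
    exact inner_self_eq_zero.1 (hy y (by simp [key V h y h2 i, key V' h' y h2 i]))
  ext x
  have hx : x ∈ (V i - V' i).ker := hker ▸ Submodule.mem_top
  exact sub_eq_zero.1 (by simpa using hx)

/-- The partial isometry `V = (V₁, …, V_d)` of the canonical spherical polar decomposition
`T = V P`. -/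
def polarPart {d : ℕ} (T : Fin d → H →L[ℂ] H) : Fin d → H →L[ℂ] H :=
  (exists_isSphericalPolar T).choose

theorem polarPart_spec {d : ℕ} (T : Fin d → H →L[ℂ] H) : IsSphericalPolar T (polarPart T) :=
  (exists_isSphericalPolar T).choose_spec

/-- The generalized spherical Aluthge transform `(P^t V₁ P^{1-t}, …, P^t V_d P^{1-t})`, for
`t ∈ [0, 1]`. Powers of `P` are those of the continuous functional calculus, with `P^0 = I`. -/
def aluthge {d : ℕ} (T : Fin d → H →L[ℂ] H) (t : ℝ) : Fin d → H →L[ℂ] H :=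
  fun i => sphericalModulus T ^ t * polarPart T i * sphericalModulus T ^ (1 - t)

/-- The spherical Heinz transform, for `t ∈ [0, 1]`: the mean of the generalized spherical Aluthge
transforms with parameters `t` and `1 - t`. -/
def heinz {d : ℕ} (T : Fin d → H →L[ℂ] H) (t : ℝ) : Fin d → H →L[ℂ] H :=
  (1 / 2 : ℂ) • (aluthge T t + aluthge T (1 - t))

end

end SphericalTuple

/-! Since `ker P` is the joint kernel, `T² = 0` means that every `P T_j = P V_j P` vanishes. The
`V_j` vanish on `ker P`, so this improves to `P V_j = 0`, and then `P^t V_j = 0` for every `t > 0`;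
this kills all the transforms. Conversely, multiplying `P^t V_j P^(1-t) = 0` by `P^(1-t)` on the
left and `P^t` on the right returns `P V_j P = 0`. A vanishing Heinz transform says that some `X`
anticommutes with a power of `P`; positivity forces both products to be zero, and one of them is an
Aluthge transform. -/

namespace SphericalTuple

/-! ### Annihilators and anticommutation for nonnegative elements -/

section CStarAlgebra

variable {A : Type*} [CStarAlgebra A] [PartialOrder A] [StarOrderedRing A]

/-- Real powers of a nonnegative element are additive in nonnegative exponents. -/
lemma rpow_add_of_exponent_nonneg {a : A} (ha : 0 ≤ a) {s t : ℝ} (hs : 0 ≤ s) (ht : 0 ≤ t) :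
    a ^ (s + t) = a ^ s * a ^ t := by
  rcases hs.eq_or_lt with rfl | hs
  · rw [CFC.rpow_zero a ha, zero_add, one_mul]
  rcases ht.eq_or_lt with rfl | ht
  · rw [CFC.rpow_zero a ha, add_zero, mul_one]
  lift s to NNReal using hs.le
  lift t to NNReal using ht.le
  rw [NNReal.coe_pos] at hs ht
  rw [← NNReal.coe_add, ← CFC.nnrpow_eq_rpow (add_pos hs ht), ← CFC.nnrpow_eq_rpow hs,
    ← CFC.nnrpow_eq_rpow ht, CFC.nnrpow_add hs ht]

lemma star_rpow (a : A) (s : ℝ) : star (a ^ s) = a ^ s :=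
  (IsSelfAdjoint.of_nonneg CFC.rpow_nonneg).star_eq

/-- Positive powers of a nonnegative element have the same right annihilator. -/
lemma rpow_mul_eq_zero {a x : A} (ha : 0 ≤ a) (h : a * x = 0) {s : ℝ} (hs : 0 < s) :
    a ^ s * x = 0 := by
  -- Doubling `s` some `n` times gives an exponent at least `1`, where `a` itself splits off as a
  -- factor.
  obtain ⟨n, hn⟩ := pow_unbounded_of_one_lt s⁻¹ (one_lt_two : (1 : ℝ) < 2)
  replace hn : 1 ≤ 2 ^ n * s := by
    have := mul_lt_mul_of_pos_right hn hs
    rw [inv_mul_cancel₀ hs.ne'] at this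
    exact this.le
  induction n generalizing s with
  | zero =>
    have hs1 : 0 ≤ s - 1 := by linarith
    have h1 := rpow_add_of_exponent_nonneg ha hs1 zero_le_one
    rw [sub_add_cancel, CFC.rpow_one a ha] at h1
    rw [h1, mul_assoc, h, mul_zero]
  | succ n ih =>
    have h2 : a ^ (s + s) * x = 0 := ih (by linarith) (by rw [pow_succ] at hn; linarith)
    rw [rpow_add_of_exponent_nonneg ha hs.le hs.le] at h2
    -- The C⋆-identity halves the exponent: `(a^s x)* (a^s x) = x* a^(2s) x = 0`.
    rw [← CStarRing.star_mul_self_eq_zero_iff, star_mul, star_rpow, mul_assoc, ← mul_assoc (a ^ s),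
      h2, mul_zero]

/-- Positive powers of a nonnegative element have the same left annihilator. -/
lemma mul_rpow_eq_zero {a x : A} (ha : 0 ≤ a) (h : x * a = 0) {s : ℝ} (hs : 0 < s) :
    x * a ^ s = 0 := by
  have h1 : a * star x = 0 := by
    rw [← (IsSelfAdjoint.of_nonneg ha).star_eq, ← star_mul, h, star_zero]
  have h2 := congrArg star (rpow_mul_eq_zero ha h1 hs)
  rwa [star_mul, star_star, star_rpow, star_zero] at h2

/-- An element that anticommutes with a nonnegative element is annihilated by it. -/
lemma mul_eq_zero_of_add_mul_eq_zero {a x : A} (ha : 0 ≤ a) (h : x * a + a * x = 0) :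
    a * x = 0 := by
  have h1 : x * a = -(a * x) := eq_neg_of_add_eq_zero_left h
  have h2 : Commute (a * a) x := by
    change a * a * x = x * (a * a)
    rw [← mul_assoc x, h1, neg_mul, mul_assoc a x a, h1, mul_neg, neg_neg, mul_assoc]
  -- `a` is the square root of `a * a`, so it commutes with whatever `a * a` commutes with.
  have h3 : Commute a x := by
    have := h2.cfcₙ_nnreal NNReal.sqrt
    rwa [← CFC.sqrt, CFC.sqrt_mul_self a ha] at this
  rw [← h3.eq, ← two_smul ℂ, smul_eq_zero] at h
  exact h.resolve_left two_ne_zero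

end CStarAlgebra

/-! ### Tuples, their polar parts and their transforms -/

section Transforms

variable {H : Type*} [NormedAddCommGroup H] [InnerProductSpace ℂ H]
  {d : ℕ} (T : Fin d → H →L[ℂ] H)

lemma tupleSq_eq_zero_iff_mul : tupleSq T = 0 ↔ ∀ i j, T i * T j = 0 := by
  constructor
  · intro h i j
    have := congrFun h (finProdFinEquiv (i, j))
    -- The inverse of `finProdFinEquiv` is `(divNat, modNat)`, the indexing used by `tupleProd`.
    have h2 := finProdFinEquiv.symm_apply_apply (i, j)
    rw [finProdFinEquiv_symm_apply, Prod.mk.injEq] at h2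
    simpa only [tupleSq, tupleProd, h2.1, h2.2, Pi.zero_apply] using this
  · intro h
    funext k
    exact h _ _

variable [CompleteSpace H]

lemma sphericalModulus_nonneg : 0 ≤ sphericalModulus T := CFC.sqrt_nonneg _

/-- The projection `∑ Vᵢ* Vᵢ` kills `x`, so `∑ ‖Vᵢ x‖² = 0`. -/
lemma IsSphericalPolar.apply_eq_zero {T V : Fin d → H →L[ℂ] H} (h : IsSphericalPolar T V) {x : H}
    (hx : x ∈ jointKernel T) (i : Fin d) : V i x = 0 := by
  have h1 := inner_sum_star_mul V x
  have h2 : (jointKernel T)ᗮ.starProjection x = 0 :=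
    (Submodule.starProjection_apply_eq_zero_iff _).2 (Submodule.le_orthogonal_orthogonal _ hx)
  rw [h.initial, h2, inner_zero_left, eq_comm, Complex.ofReal_eq_zero,
    Finset.sum_eq_zero_iff_of_nonneg fun _ _ => sq_nonneg _] at h1
  simpa using h1 i (Finset.mem_univ i)

/-- Both sides say that each `T j` has its range in the joint kernel, which is `ker P`. -/
lemma tupleSq_eq_zero_iff_modulus :
    tupleSq T = 0 ↔ ∀ j, sphericalModulus T * T j = 0 := by
  rw [tupleSq_eq_zero_iff_mul, forall_comm]
  refine forall_congr' fun j => ?_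
  simp only [ContinuousLinearMap.ext_iff]
  rw [forall_comm]
  refine forall_congr' fun x => Iff.trans ?_ (sphericalModulus_apply_eq_zero_iff T (T j x)).symm
  rw [jointKernel, Submodule.mem_iInf]
  rfl

/-- If `P` is self-adjoint and `V` vanishes on `ker P`, then `P V P = 0` forces `P V = 0`. -/
lemma mul_eq_zero_of_mul_mul_eq_zero {P V : H →L[ℂ] H} (hP : IsSelfAdjoint P)
    (hV : ∀ x, P x = 0 → V x = 0) (h : P * (V * P) = 0) : P * V = 0 := by
  have h1 : P * (star V * P) = 0 := by
    have := congrArg star h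
    rwa [star_mul, star_mul, hP.star_eq, star_zero, mul_assoc] at this
  -- The range of `V* P` lies in `ker P`, hence in `ker V`, so `‖V* P x‖² = ⟪P x, V V* P x⟫ = 0`.
  have h2 : star V * P = 0 := by
    refine ContinuousLinearMap.ext fun x => ?_
    have hy : V (star V (P x)) = 0 := hV _ (DFunLike.congr_fun h1 x)
    have h3 : ⟪star V (P x), star V (P x)⟫_ℂ = ⟪P x, V (star V (P x))⟫_ℂ :=
      ContinuousLinearMap.adjoint_inner_left V (star V (P x)) (P x)
    rw [hy, inner_zero_right] at h3
    exact inner_self_eq_zero.1 h3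
  have := congrArg star h2
  rwa [star_mul, star_star, hP.star_eq, star_zero] at this

/-- If `P T_j = 0`, then already `P V_j = 0`. -/
lemma modulus_mul_polarPart_eq_zero {j : Fin d} (h : sphericalModulus T * T j = 0) :
    sphericalModulus T * polarPart T j = 0 := by
  refine mul_eq_zero_of_mul_mul_eq_zero (IsSelfAdjoint.of_nonneg (sphericalModulus_nonneg T))
    (fun x hx => (polarPart_spec T).apply_eq_zero
      ((sphericalModulus_apply_eq_zero_iff T x).1 hx) j) ?_
  rw [← (polarPart_spec T).eq_mul j, h]

lemma aluthge_eq_zero_of_tupleSq_eq_zero (h : tupleSq T = 0) {t : ℝ} (ht : 0 < t) :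
    aluthge T t = 0 := by
  funext j
  have h1 := modulus_mul_polarPart_eq_zero T ((tupleSq_eq_zero_iff_modulus T).1 h j)
  simp only [aluthge, rpow_mul_eq_zero (sphericalModulus_nonneg T) h1 ht, zero_mul, Pi.zero_apply]

lemma tupleSq_eq_zero_of_aluthge_eq_zero {t : ℝ} (ht0 : 0 ≤ t) (ht1 : t ≤ 1)
    (h : aluthge T t = 0) : tupleSq T = 0 := by
  rw [tupleSq_eq_zero_iff_modulus]
  intro j
  have hP := sphericalModulus_nonneg T
  have h1 : (1 - t) + t = 1 := by ring
  have e1 := rpow_add_of_exponent_nonneg hP (sub_nonneg.2 ht1) ht0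
  have e2 := rpow_add_of_exponent_nonneg hP ht0 (sub_nonneg.2 ht1)
  rw [h1, CFC.rpow_one _ hP] at e1
  rw [add_comm, h1, CFC.rpow_one _ hP] at e2
  have h2 : sphericalModulus T ^ t * polarPart T j * sphericalModulus T ^ (1 - t) = 0 :=
    congrFun h j
  calc sphericalModulus T * T j
      = sphericalModulus T * (polarPart T j * sphericalModulus T) := by
        rw [← (polarPart_spec T).eq_mul j]
    _ = (sphericalModulus T ^ (1 - t) * sphericalModulus T ^ t) *
          (polarPart T j * (sphericalModulus T ^ (1 - t) * sphericalModulus T ^ t)) := by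
        rw [← e1]
    _ = sphericalModulus T ^ (1 - t) *
          (sphericalModulus T ^ t * polarPart T j * sphericalModulus T ^ (1 - t)) *
          sphericalModulus T ^ t := by
        simp only [mul_assoc]
    _ = 0 := by rw [h2, mul_zero, zero_mul]

lemma heinz_one_sub (t : ℝ) : heinz T (1 - t) = heinz T t := by
  rw [heinz, heinz, sub_sub_cancel, add_comm]

/-- With `X = P^t V_j P^t`, the hypothesis reads `X P^(1-2t) + P^(1-2t) X = 0`. The bound on `t`
keeps the exponent nonnegative, and `P^(1-2t) X` is the Aluthge transform at `1 - t`. -/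
lemma tupleSq_eq_zero_of_heinz_eq_zero_of_le_half {t : ℝ} (ht0 : 0 ≤ t) (ht1 : t ≤ 1 / 2)
    (h : heinz T t = 0) : tupleSq T = 0 := by
  refine tupleSq_eq_zero_of_aluthge_eq_zero T (t := 1 - t) (by linarith) (by linarith) ?_
  rw [heinz, smul_eq_zero] at h
  replace h := h.resolve_left (by norm_num)
  funext j
  have hP := sphericalModulus_nonneg T
  have hs : 0 ≤ 1 - 2 * t := by linarith
  have e1 := rpow_add_of_exponent_nonneg hP hs ht0
  have e2 := rpow_add_of_exponent_nonneg hP ht0 hs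
  rw [show 1 - 2 * t + t = 1 - t by ring] at e1
  rw [show t + (1 - 2 * t) = 1 - t by ring] at e2
  have hj := congrFun h j
  simp only [Pi.add_apply, aluthge, sub_sub_cancel, Pi.zero_apply] at hj ⊢
  have h1 : (sphericalModulus T ^ t * (polarPart T j * sphericalModulus T ^ t)) *
        sphericalModulus T ^ (1 - 2 * t) +
      sphericalModulus T ^ (1 - 2 * t) *
        (sphericalModulus T ^ t * (polarPart T j * sphericalModulus T ^ t)) = 0 := by
    rw [← hj, ← mul_assoc (sphericalModulus T ^ (1 - 2 * t)), ← e1, e2]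
    simp only [mul_assoc]
  have h2 := mul_eq_zero_of_add_mul_eq_zero CFC.rpow_nonneg h1
  rwa [← mul_assoc, ← e1, ← mul_assoc] at h2

/-- The symmetry `t ↔ 1 - t` of the Heinz transform reduces to `t ≤ 1/2`. -/
lemma tupleSq_eq_zero_of_heinz_eq_zero {t : ℝ} (ht0 : 0 ≤ t) (ht1 : t ≤ 1)
    (h : heinz T t = 0) : tupleSq T = 0 := by
  rcases le_total t (1 / 2) with ht | ht
  · exact tupleSq_eq_zero_of_heinz_eq_zero_of_le_half T ht0 ht h
  · exact tupleSq_eq_zero_of_heinz_eq_zero_of_le_half T (t := 1 - t) (by linarith) (by linarith)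
      ((heinz_one_sub T t).trans h)

end Transforms

end SphericalTuple

theorem theorem2p7 {H : Type*} [NormedAddCommGroup H] [InnerProductSpace ℂ H] [CompleteSpace H]
    {d : ℕ} (T : Fin d → H →L[ℂ] H) :
    List.TFAE [
      SphericalTuple.tupleSq T = 0,
      ∀ t ∈ Set.Ioc (0 : ℝ) 1, SphericalTuple.aluthge T t = 0,
      ∃ t ∈ Set.Ioc (0 : ℝ) 1, SphericalTuple.aluthge T t = 0,
      ∀ t ∈ Set.Ioo (0 : ℝ) 1, SphericalTuple.heinz T t = 0,
      ∃ t ∈ Set.Ioo (0 : ℝ) 1, SphericalTuple.heinz T t = 0] := by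
  tfae_have 1 → 2 := fun h t ht => SphericalTuple.aluthge_eq_zero_of_tupleSq_eq_zero T h ht.1
  tfae_have 2 → 3 := fun h => ⟨1, by norm_num, h 1 (by norm_num)⟩
  tfae_have 3 → 1 := fun ⟨t, ht, h⟩ =>
    SphericalTuple.tupleSq_eq_zero_of_aluthge_eq_zero T ht.1.le ht.2 h
  tfae_have 2 → 4 := fun h t ht => by
    rw [SphericalTuple.heinz, h t ⟨ht.1, ht.2.le⟩, h (1 - t) ⟨by linarith [ht.2], by linarith [ht.1]⟩,
      add_zero, smul_zero]
  tfae_have 4 → 5 := fun h => ⟨1 / 2, by norm_num, h (1 / 2) (by norm_num)⟩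
  tfae_have 5 → 1 := fun ⟨t, ht, h⟩ =>
    SphericalTuple.tupleSq_eq_zero_of_heinz_eq_zero T ht.1.le ht.2.le h
  tfae_finish
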